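/- Let $F_2$ be the free group of rank $2$ and let $\varphi\in\mathrm{Aut}(F_2)$. Let $G=F_2\rtimes_\varphi\mathbb{Z}$ be the semidirect product of $F_2$ with an infinite cyclic group $\langle t\rangle$ in which $t^{-1}xt=\varphi(x)$ for all $x\in F_2$. Let $[\overline\varphi]\in\mathrm{GL}_2(\mathbb{Z})$ be the matrix, in the basis given by the free generators, of the automorphism $\overline\varphi$ that $\varphi$ induces on the abelianization $F_2^{ab}=F_2/[F_2,F_2]\cong\mathbb{Z}^2$. Suppose that $\det[\overline\varphi]=1$. Then $G$ is residually nilpotent (that is, for every $g\in G$ with $g\neq 1$ there is a normal subgroup $N$ of $G$ with $g\notin N$ and $G/N$ nilpotent) if and only if $\mathrm{tr}[\overline\varphi]\notin\{1,3\}$. -/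

import Mathlib

/-- A group is residually nilpotent if every non-identity element lies outside some normal
subgroup with nilpotent quotient. -/
def IsResiduallyNilpotent (G : Type*) [Group G] : Prop :=
  ∀ g : G, g ≠ 1 → ∃ N : Subgroup G, ∃ _ : N.Normal, g ∉ N ∧ Group.IsNilpotent (G ⧸ N)

/-- The mapping torus `F_n ⋊_φ ℤ`. The generator `t` of the infinite cyclic group
`Multiplicative ℤ` acts by `x ↦ t x t⁻¹ = φ⁻¹ x`, so that `t⁻¹ x t = φ x`
(see `FreeByCyclic.inv_t_mul_inl_mul_t`). -/
abbrev FreeByCyclic {n : ℕ} (φ : MulAut (FreeGroup (Fin n))) : Type :=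
  FreeGroup (Fin n) ⋊[zpowersHom (MulAut (FreeGroup (Fin n))) φ⁻¹] Multiplicative ℤ

/-- The generator `t` of the infinite cyclic factor. -/
def FreeByCyclic.t {n : ℕ} (φ : MulAut (FreeGroup (Fin n))) : FreeByCyclic φ :=
  SemidirectProduct.inr (Multiplicative.ofAdd 1)

theorem FreeByCyclic.inv_t_mul_inl_mul_t {n : ℕ} (φ : MulAut (FreeGroup (Fin n)))
    (x : FreeGroup (Fin n)) :
    (FreeByCyclic.t φ)⁻¹ * SemidirectProduct.inl x * FreeByCyclic.t φ =
      SemidirectProduct.inl (φ x) := by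
  have e : (zpowersHom (MulAut (FreeGroup (Fin n))) φ⁻¹ (Multiplicative.ofAdd 1))⁻¹ x = φ x := by
    simp
  rw [FreeByCyclic.t, ← map_inv SemidirectProduct.inr, ← SemidirectProduct.inl_aut_inv, e]

/-- The abelianization of `F_n`, written additively, as a `ℤ`-module. -/
abbrev FreeGroupAb (n : ℕ) : Type := Additive (Abelianization (FreeGroup (Fin n)))

/-- The basis of `F_n^{ab}` formed by the classes of the free generators. -/
noncomputable def freeGroupAbBasis (n : ℕ) : Module.Basis (Fin n) ℤ (FreeGroupAb n) :=
  FreeAbelianGroup.basis (Fin n)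

theorem freeGroupAbBasis_apply (n : ℕ) (i : Fin n) :
    freeGroupAbBasis n i = Additive.ofMul (Abelianization.of (FreeGroup.of i)) := by
  change FreeAbelianGroup.basis (Fin n) i = FreeAbelianGroup.of i
  simp [FreeAbelianGroup.basis]

/-- The `ℤ`-linear endomorphism of `F_n^{ab}` induced by an automorphism of `F_n`. -/
def abelianizedAut {n : ℕ} (φ : MulAut (FreeGroup (Fin n))) :
    FreeGroupAb n →ₗ[ℤ] FreeGroupAb n :=
  (MonoidHom.toAdditive (Abelianization.map φ.toMonoidHom)).toIntLinearMap

/-- The matrix of the induced automorphism of `F_n^{ab}` in the standard basis. -/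
noncomputable def abelianizedMatrix {n : ℕ} (φ : MulAut (FreeGroup (Fin n))) :
    Matrix (Fin n) (Fin n) ℤ :=
  LinearMap.toMatrix (freeGroupAbBasis n) (freeGroupAbBasis n) (abelianizedAut φ)

/-! ### Powers of elements congruent to `1` modulo a prime -/

/-! Write `A` for the induced map on the abelianization and `τ` for its trace. As `det A = 1`,
Cayley–Hamilton reads `(A - 1)² = (τ - 2) A`, so everything depends on whether `τ - 2` is a unit of
`ℤ`.

If `τ - 2 = ±1`, then `A - 1` is invertible, so a `φ`-invariant homomorphism from `F₂` to an abelian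
group is trivial. Induction along centres shows that `F₂` dies in every nilpotent quotient of `G`
(`apply_inl_eq_one_of_isNilpotent`).

Otherwise a prime `p` divides `τ - 2` and `A` is unipotent mod `p`. Hence some `p`-power of `φ`
fixes all homomorphisms from `F₂` to a given finite `p`-group `P` (`exists_apply_pow_eq`), and `G`
acts on the finite set `Hom(F₂, P) × P` through a `p`-group. Since `F₂` is residually finite-`p`,
these actions detect `F₂`; the remaining elements survive in `ℤ`. -/

theorem pow_succ_dvd_pow_sub_one {R : Type*} [Ring R] {p : ℕ} (hp : p.Prime) {j : ℕ}
    (hj : 1 ≤ j) {x : R} (h : ((p ^ j : ℕ) : R) ∣ x - 1) :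
    ((p ^ (j + 1) : ℕ) : R) ∣ x ^ p - 1 := by
  obtain ⟨r, hr⟩ := (Commute.one_right (x - 1)).exists_add_pow_prime_eq hp
  rw [sub_add_cancel, one_pow, mul_one] at hr
  obtain ⟨y, hy⟩ := h
  have h1 : ((p ^ (j + 1) : ℕ) : R) ∣ (x - 1) ^ p := by
    rw [hy, (Nat.cast_commute (p ^ j) y).mul_pow, ← Nat.cast_pow, ← pow_mul]
    refine Dvd.dvd.mul_right (Nat.cast_dvd_cast (pow_dvd_pow p ?_)) _
    nlinarith [hp.two_le]
  have h2 : ((p ^ (j + 1) : ℕ) : R) ∣ p * (x - 1) * r := by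
    rw [hy, ← mul_assoc (p : R), ← Nat.cast_mul, ← pow_succ', mul_assoc]
    exact dvd_mul_right _ _
  have h3 : x ^ p - 1 = (x - 1) ^ p + p * (x - 1) * r := by rw [hr]; abel
  rw [h3]
  exact dvd_add h1 h2

theorem pow_succ_dvd_pow_pow_sub_one {R : Type*} [Ring R] {p : ℕ} (hp : p.Prime) {x : R}
    (h : (p : R) ∣ x - 1) (j : ℕ) : ((p ^ (j + 1) : ℕ) : R) ∣ x ^ p ^ j - 1 := by
  induction j with
  | zero => simpa using h
  | succ j ih =>
    rw [pow_succ p j, pow_mul]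
    exact pow_succ_dvd_pow_sub_one hp (by omega) ih

/-- Modulo `p`, `x ^ p - 1` is `(x - 1) ^ p`, a multiple of `(x - 1) ^ 2` because `p ≥ 2`. -/
theorem dvd_pow_sub_one_of_dvd_sq {R : Type*} [Ring R] {p : ℕ} (hp : p.Prime) {x : R}
    (h : (p : R) ∣ (x - 1) ^ 2) : (p : R) ∣ x ^ p - 1 := by
  obtain ⟨r, hr⟩ := (Commute.one_right (x - 1)).exists_add_pow_prime_eq hp
  rw [sub_add_cancel, one_pow, mul_one] at hr
  have h3 : x ^ p - 1 = (x - 1) ^ p + p * (x - 1) * r := by rw [hr]; abel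
  rw [h3, mul_assoc]
  refine dvd_add ?_ (dvd_mul_right _ _)
  obtain ⟨k, hk⟩ := Nat.exists_eq_add_of_le hp.two_le
  have h4 : (x - 1) ^ p = (x - 1) ^ 2 * (x - 1) ^ k := by rw [← pow_add, ← hk]
  exact h4 ▸ h.mul_right _

/-! ### The induced automorphism of the abelianization -/

section Abelianization

variable {n : ℕ} (φ : MulAut (FreeGroup (Fin n)))

theorem abelianizedAut_pow_of (k : ℕ) (x : FreeGroup (Fin n)) :
    (abelianizedAut φ ^ k) (Additive.ofMul (Abelianization.of x)) =
      Additive.ofMul (Abelianization.of ((φ ^ k) x)) := by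
  induction k generalizing x with
  | zero => rfl
  | succ k ih =>
    rw [pow_succ, pow_succ, Module.End.mul_apply]
    exact ih (φ x)

/-- The linear map on the abelianization of `F_n` induced by a homomorphism to a commutative
group. -/
def abelianizedLift {A : Type*} [CommGroup A] (f : FreeGroup (Fin n) →* A) :
    FreeGroupAb n →ₗ[ℤ] Additive A :=
  (MonoidHom.toAdditive (Abelianization.lift f)).toIntLinearMap

theorem abelianizedLift_of {A : Type*} [CommGroup A] (f : FreeGroup (Fin n) →* A)
    (x : FreeGroup (Fin n)) :
    abelianizedLift f (Additive.ofMul (Abelianization.of x)) = Additive.ofMul (f x) := rfl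

/-- If `d ∣ φ̄ ^ k - 1` on the abelianization, then `φ ^ k` fixes all homomorphisms to commutative
groups of exponent dividing `d`. -/
theorem apply_pow_eq_of_dvd {A : Type*} [CommGroup A] {d k : ℕ}
    (h : (d : Module.End ℤ (FreeGroupAb n)) ∣ abelianizedAut φ ^ k - 1)
    (hA : ∀ a : A, a ^ d = 1) (f : FreeGroup (Fin n) →* A) (x : FreeGroup (Fin n)) :
    f ((φ ^ k) x) = f x := by
  obtain ⟨u, hu⟩ := h
  have h1 := congrArg (abelianizedLift f)
    (LinearMap.congr_fun hu (Additive.ofMul (Abelianization.of x)))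
  rw [LinearMap.sub_apply, abelianizedAut_pow_of, Module.End.one_apply, map_sub,
    abelianizedLift_of, abelianizedLift_of, Module.End.mul_apply, Module.End.natCast_apply,
    map_nsmul, sub_eq_iff_eq_add] at h1
  have h2 : ∀ a : Additive A, d • a = 0 := fun a => hA a.toMul
  rw [h2, zero_add] at h1
  exact h1

end Abelianization

theorem abelianizedAut_sq {φ : MulAut (FreeGroup (Fin 2))} (hdet : (abelianizedMatrix φ).det = 1) :
    abelianizedAut φ ^ 2 - (abelianizedMatrix φ).trace • abelianizedAut φ + 1 = 0 := by
  have h := Matrix.aeval_self_charpoly (abelianizedMatrix φ)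
  rw [Matrix.charpoly_fin_two, hdet] at h
  have h' := congrArg (LinearMap.toMatrixAlgEquiv (freeGroupAbBasis 2)).symm h
  have e : (LinearMap.toMatrixAlgEquiv (freeGroupAbBasis 2)).symm (abelianizedMatrix φ) =
      abelianizedAut φ :=
    (LinearMap.toMatrixAlgEquiv (freeGroupAbBasis 2)).symm_apply_apply (abelianizedAut φ)
  rw [← AlgEquiv.coe_toAlgHom, ← Polynomial.aeval_algHom_apply, AlgEquiv.coe_toAlgHom, e] at h'
  simpa [zsmul_eq_mul] using h'

theorem abelianizedAut_sub_one_sq {φ : MulAut (FreeGroup (Fin 2))}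
    (hdet : (abelianizedMatrix φ).det = 1) :
    (abelianizedAut φ - 1) ^ 2 =
      (((abelianizedMatrix φ).trace - 2 : ℤ) : Module.End ℤ (FreeGroupAb 2)) *
        abelianizedAut φ := by
  have h := abelianizedAut_sq hdet
  rw [zsmul_eq_mul] at h
  have e : (abelianizedAut φ - 1) ^ 2 = (abelianizedAut φ ^ 2 -
      ((abelianizedMatrix φ).trace : Module.End ℤ (FreeGroupAb 2)) * abelianizedAut φ + 1) +
      (((abelianizedMatrix φ).trace - 2 : ℤ) : Module.End ℤ (FreeGroupAb 2)) *
        abelianizedAut φ := by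
    push_cast
    noncomm_ring
  rw [e, h, zero_add]

theorem pow_dvd_abelianizedAut_pow_sub_one {φ : MulAut (FreeGroup (Fin 2))}
    (hdet : (abelianizedMatrix φ).det = 1) {p : ℕ} (hp : p.Prime)
    (htr : (p : ℤ) ∣ (abelianizedMatrix φ).trace - 2) {a k : ℕ} (hak : a ≤ k) :
    ((p ^ a : ℕ) : Module.End ℤ (FreeGroupAb 2)) ∣ abelianizedAut φ ^ p ^ k - 1 := by
  have h1 : (p : Module.End ℤ (FreeGroupAb 2)) ∣ abelianizedAut φ ^ p - 1 := by
    refine dvd_pow_sub_one_of_dvd_sq hp ?_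
    rw [abelianizedAut_sub_one_sq hdet]
    obtain ⟨c, hc⟩ := htr
    rw [hc]
    push_cast
    rw [mul_assoc]
    exact dvd_mul_right _ _
  rcases k with _ | k
  · obtain rfl : a = 0 := by omega
    simp
  · have h2 := pow_succ_dvd_pow_pow_sub_one hp h1 k
    rw [← pow_mul, ← pow_succ'] at h2
    exact (Nat.cast_dvd_cast (pow_dvd_pow p hak)).trans h2

/-! ### Nilpotent quotients when the trace is `1` or `3` -/

/-- Invariance makes `f` vanish on the image of `A - 1`; applying `f` to `(A - 1)² = ±A` leaves `0 =
±f x`. -/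
theorem eq_one_of_apply_aut_eq {φ : MulAut (FreeGroup (Fin 2))}
    (hdet : (abelianizedMatrix φ).det = 1)
    (htr : (abelianizedMatrix φ).trace ∈ ({1, 3} : Set ℤ)) {A : Type*} [CommGroup A]
    (f : FreeGroup (Fin 2) →* A) (hf : ∀ x, f (φ x) = f x) (x : FreeGroup (Fin 2)) : f x = 1 := by
  have h := LinearMap.congr_fun (abelianizedAut_sub_one_sq hdet)
    (Additive.ofMul (Abelianization.of x))
  have h0 (v : FreeGroupAb 2) : abelianizedLift f ((abelianizedAut φ - 1) v) = 0 := by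
    obtain ⟨y, rfl⟩ : ∃ y, Additive.ofMul (Abelianization.of y) = v :=
      QuotientGroup.mk_surjective (s := commutator (FreeGroup (Fin 2))) v.toMul
    have := abelianizedAut_pow_of φ 1 y
    rw [pow_one, pow_one] at this
    rw [LinearMap.sub_apply, this, Module.End.one_apply, map_sub, abelianizedLift_of,
      abelianizedLift_of, hf, sub_self]
  have h1 := congrArg (abelianizedLift f) h
  have h2 := abelianizedAut_pow_of φ 1 x
  rw [pow_one, pow_one] at h2
  rw [pow_two, Module.End.mul_apply, h0, Module.End.mul_apply, Module.End.intCast_apply, h2,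
    map_zsmul, abelianizedLift_of, hf] at h1
  have h3 : Additive.ofMul (f x) = 0 := by
    rcases htr with h | h
    · rw [h] at h1; simpa using h1.symm
    · rw [Set.mem_singleton_iff] at h
      rw [h] at h1; simpa using h1.symm
  exact h3

theorem apply_inl_eq_one_of_isNilpotent {φ : MulAut (FreeGroup (Fin 2))}
    (hdet : (abelianizedMatrix φ).det = 1)
    (htr : (abelianizedMatrix φ).trace ∈ ({1, 3} : Set ℤ)) (Q : Type*) [Group Q]
    [Group.IsNilpotent Q] (h : FreeByCyclic φ →* Q) (x : FreeGroup (Fin 2)) :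
    h (SemidirectProduct.inl x) = 1 := by
  revert h x
  refine Group.nilpotent_center_quotient_ind
    (P := fun Q _ _ => ∀ (h : FreeByCyclic φ →* Q) x, h (SemidirectProduct.inl x) = 1) Q ?_ ?_
  · intro Q _ _ h x
    exact Subsingleton.elim _ _
  · intro Q _ _ ih h x
    -- By induction `F₂` dies modulo the centre, so its image is central and conjugation by `t` does
    -- not move it.
    have hc (x) : (h.comp SemidirectProduct.inl) x ∈ Subgroup.center Q := by
      have := ih ((QuotientGroup.mk' _).comp h) x
      exact (QuotientGroup.eq_one_iff _).1 this
    let f := (h.comp SemidirectProduct.inl).codRestrict (Subgroup.center Q) hc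
    have hf (x) : f (φ x) = f x := by
      apply Subtype.ext
      change h (SemidirectProduct.inl (φ x)) = h (SemidirectProduct.inl x)
      have hx : h (FreeByCyclic.t φ) * h (SemidirectProduct.inl x) =
        h (SemidirectProduct.inl x) * h (FreeByCyclic.t φ) := Subgroup.mem_center_iff.1 (hc x) _
      rw [← FreeByCyclic.inv_t_mul_inl_mul_t, map_mul, map_mul, mul_assoc, ← hx, map_inv,
        inv_mul_cancel_left]
    let _ : CommGroup (Subgroup.center Q) := IsMulCommutative.instCommGroup
    have hfx : f x = 1 := eq_one_of_apply_aut_eq (A := Subgroup.center Q) hdet htr f hf x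
    exact congrArg Subtype.val hfx

theorem not_isResiduallyNilpotent {φ : MulAut (FreeGroup (Fin 2))}
    (hdet : (abelianizedMatrix φ).det = 1)
    (htr : (abelianizedMatrix φ).trace ∈ ({1, 3} : Set ℤ)) :
    ¬ IsResiduallyNilpotent (FreeByCyclic φ) := by
  intro hG
  obtain ⟨N, _, hN, _⟩ := hG (SemidirectProduct.inl (FreeGroup.of 0)) fun h =>
    FreeGroup.of_ne_one 0 (SemidirectProduct.inl_injective (h.trans (map_one _).symm))
  exact hN ((QuotientGroup.eq_one_iff _).1
    (apply_inl_eq_one_of_isNilpotent hdet htr _ (QuotientGroup.mk' N) (FreeGroup.of 0)))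

/-! ### Automorphisms acting on homomorphisms to finite `p`-groups -/

/-- Induction along centres. If `ψ` acts trivially modulo the centre, the defect `c x = (f x)⁻¹ * f
(ψ x)` is a homomorphism to the centre. Once `ψ` also fixes `c`, iterating gives `f (ψ ^ j x) = f x
* c x ^ j`, and the exponent of the centre kills the defect. -/
theorem exists_apply_pow_eq {φ : MulAut (FreeGroup (Fin 2))}
    (hdet : (abelianizedMatrix φ).det = 1) {p : ℕ} (hp : p.Prime)
    (htr : (p : ℤ) ∣ (abelianizedMatrix φ).trace - 2) (P : Type*) [Group P]
    [Finite P] (hP : IsPGroup p P) :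
    ∃ m : ℕ, ∀ (f : FreeGroup (Fin 2) →* P) (x : FreeGroup (Fin 2)),
      f ((φ ^ p ^ m) x) = f x := by
  have : Fact p.Prime := ⟨hp⟩
  have := hP.isNilpotent
  suffices H : Finite P → IsPGroup p P → ∃ m : ℕ, ∀ (f : FreeGroup (Fin 2) →* P)
      (x : FreeGroup (Fin 2)), f ((φ ^ p ^ m) x) = f x from H inferInstance hP
  clear hP
  refine Group.nilpotent_center_quotient_ind
    (P := fun P _ _ => Finite P → IsPGroup p P → ∃ m : ℕ, ∀ (f : FreeGroup (Fin 2) →* P)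
      (x : FreeGroup (Fin 2)), f ((φ ^ p ^ m) x) = f x) P ?_ ?_
  · intro P _ _ _ _
    exact ⟨0, fun _ _ => Subsingleton.elim _ _⟩
  · intro P _ _ ih hfin hP
    obtain ⟨m, hm⟩ := ih inferInstance (hP.to_quotient _)
    obtain ⟨a, ha⟩ := IsPGroup.iff_card.1 (hP.to_subgroup (Subgroup.center P))
    have hZ (z : Subgroup.center P) : z ^ p ^ a = 1 := ha ▸ pow_card_eq_one'
    -- `m` handles the quotient and `a` the centre, of order `p ^ a`; a further `p ^ a`-th power
    -- will remove `c`.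
    set ψ := φ ^ p ^ (m + a) with hψ
    have h1 (f : FreeGroup (Fin 2) →* P ⧸ Subgroup.center P) (x) : f (ψ x) = f x := by
      rw [hψ, pow_add, pow_mul]
      generalize p ^ a = k
      induction k generalizing x with
      | zero => rfl
      | succ k ih => rw [pow_succ, MulAut.mul_apply, ih, hm]
    let _ : CommGroup (Subgroup.center P) := IsMulCommutative.instCommGroup
    have h2 (f : FreeGroup (Fin 2) →* Subgroup.center P) (x) : f (ψ x) = f x :=
      apply_pow_eq_of_dvd φ
        (pow_dvd_abelianizedAut_pow_sub_one hdet hp htr (Nat.le_add_left a m)) hZ f x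
    refine ⟨m + a + a, fun f x => ?_⟩
    have hc (x) : (f x)⁻¹ * f (ψ x) ∈ Subgroup.center P := by
      rw [← QuotientGroup.eq]
      exact (h1 ((QuotientGroup.mk' _).comp f) x).symm
    let c : FreeGroup (Fin 2) →* Subgroup.center P := MonoidHom.mk'
      (fun x => ⟨(f x)⁻¹ * f (ψ x), hc x⟩) fun x y => Subtype.ext <| by
        have := Subgroup.mem_center_iff.1 (hc x) (f y)⁻¹
        simp only [map_mul, Subgroup.coe_mul, mul_inv_rev]
        rw [← mul_assoc ((f x)⁻¹ * f (ψ x)), ← this]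
        group
    have h3 (j : ℕ) (x) : f ((ψ ^ j) x) = f x * (c x ^ j : Subgroup.center P) := by
      induction j generalizing x with
      | zero => simp
      | succ j ih =>
        rw [pow_succ, MulAut.mul_apply, ih, h2, pow_succ', Subgroup.coe_mul, ← mul_assoc]
        congr 1
        exact (mul_inv_cancel_left (f x) (f (ψ x))).symm
    rw [pow_add p (m + a), pow_mul, ← hψ, h3, hZ]
    simp

/-! ### Free groups of rank two are residually finite-`p` -/

/-- The elementary matrices `!![1, q; 0, 1]` and `!![1, 0; q, 1]`. -/
def elementaryPair (q : ℤ) : Fin 2 → Matrix.SpecialLinearGroup (Fin 2) ℤ :=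
  ![⟨!![1, q; 0, 1], by simp [Matrix.det_fin_two]⟩, ⟨!![1, 0; q, 1], by simp [Matrix.det_fin_two]⟩]

theorem elementaryPair_mul_apply_self (q : ℤ) (i : Fin 2)
    (g : Matrix.SpecialLinearGroup (Fin 2) ℤ) :
    (elementaryPair q i * g).1 i 0 = g.1 i 0 + q * g.1 (i + 1) 0 := by
  change ((elementaryPair q i).1 * g.1) i 0 = _
  fin_cases i <;> simp [elementaryPair, Matrix.mul_apply, Fin.sum_univ_two, add_comm]

theorem elementaryPair_mul_apply_succ (q : ℤ) (i : Fin 2)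
    (g : Matrix.SpecialLinearGroup (Fin 2) ℤ) :
    (elementaryPair q i * g).1 (i + 1) 0 = g.1 (i + 1) 0 := by
  change ((elementaryPair q i).1 * g.1) (i + 1) 0 = _
  fin_cases i <;> simp [elementaryPair, Matrix.mul_apply, Fin.sum_univ_two]

theorem elementaryPair_inv (q : ℤ) (i : Fin 2) :
    (elementaryPair q i)⁻¹ = elementaryPair (-q) i := by
  refine inv_eq_of_mul_eq_one_right (Subtype.ext ?_)
  change (elementaryPair q i).1 * (elementaryPair (-q) i).1 = 1
  fin_cases i <;> ext j k <;> fin_cases j <;> fin_cases k <;>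
    simp [elementaryPair, Matrix.mul_apply, Fin.sum_univ_two]

/-- Here `(x, y)` is a first column with the `i`-th entry in front. The bound `q ≥ 3` is needed for
strictness when `x = -y`. -/
theorem pingPong_step {q x y : ℤ} (hq : 3 ≤ q) (hxy : ¬ (x = 0 ∧ y = 0))
    (h : ¬ (|y| < |x| ∧ x * y < 0)) : |y| < |x + q * y| ∧ 0 ≤ (x + q * y) * y := by
  rcases lt_trichotomy y 0 with hy | rfl | hy
  · have hx : x ≤ -y := by
      by_contra hx
      exact h ⟨by rw [abs_of_neg hy, lt_abs]; left; omega, by nlinarith⟩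
    have : x + q * y < y := by nlinarith
    exact ⟨by rw [abs_of_neg hy, lt_abs]; right; omega, by nlinarith⟩
  · simpa using hxy
  · have hx : -y ≤ x := by
      by_contra hx
      exact h ⟨by rw [abs_of_pos hy, lt_abs]; right; omega, by nlinarith⟩
    have : y < x + q * y := by nlinarith
    exact ⟨by rw [abs_of_pos hy, lt_abs]; left; omega, by nlinarith⟩

theorem pingPong_step_neg {q x y : ℤ} (hq : 3 ≤ q)
    (hxy : ¬ (x = 0 ∧ y = 0)) (h : ¬ (|y| < |x| ∧ 0 ≤ x * y)) :
    |y| < |x + -q * y| ∧ (x + -q * y) * y < 0 := by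
  rcases lt_trichotomy y 0 with hy | rfl | hy
  · have hx : y ≤ x := by
      by_contra hx
      exact h ⟨by rw [abs_of_neg hy, lt_abs]; right; omega, by nlinarith⟩
    have : -y < x + -q * y := by nlinarith
    exact ⟨by rw [abs_of_neg hy, lt_abs]; left; omega, by nlinarith⟩
  · simp_all
  · have hx : x ≤ y := by
      by_contra hx
      exact h ⟨by rw [abs_of_pos hy, lt_abs]; left; omega, by nlinarith⟩
    have : x + -q * y < -y := by nlinarith
    exact ⟨by rw [abs_of_pos hy, lt_abs]; right; omega, by nlinarith⟩

theorem injective_lift_elementaryPair {q : ℤ} (hq : 3 ≤ q) :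
    Function.Injective (FreeGroup.lift (elementaryPair q)) := by
  have h0 (i : Fin 2) (g : Matrix.SpecialLinearGroup (Fin 2) ℤ) :
      ¬ (g.1 i 0 = 0 ∧ g.1 (i + 1) 0 = 0) := by
    have := g.2
    rw [Matrix.det_fin_two] at this
    fin_cases i <;> simp <;> grind
  have hlt {g : Matrix.SpecialLinearGroup (Fin 2) ℤ} {i j : Fin 2}
      (hi : |g.1 (i + 1) 0| < |g.1 i 0|) (hj : |g.1 (j + 1) 0| < |g.1 j 0|) : i = j := by
    by_contra hij
    have h1 : j = i + 1 := by omega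
    have h2 : j + 1 = i := by omega
    rw [h2, h1] at hj
    exact lt_asymm hi hj
  -- The group acts on itself by left multiplication. The sets record which entry of the first
  -- column dominates, and the sign of the product separates a generator from its inverse.
  refine FreeGroup.injective_lift_of_ping_pong (elementaryPair q)
    (fun i => {g : Matrix.SpecialLinearGroup (Fin 2) ℤ |
      |g.1 (i + 1) 0| < |g.1 i 0| ∧ 0 ≤ g.1 i 0 * g.1 (i + 1) 0})
    (fun i => {g : Matrix.SpecialLinearGroup (Fin 2) ℤ |
      |g.1 (i + 1) 0| < |g.1 i 0| ∧ g.1 i 0 * g.1 (i + 1) 0 < 0}) ?_ ?_ ?_ ?_ ?_ ?_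
  · intro i
    fin_cases i
    · exact ⟨1, by simp⟩
    · exact ⟨⟨!![0, -1; 1, 0], by simp [Matrix.det_fin_two]⟩,
        show |(0 : ℤ)| < |1| ∧ (0 : ℤ) ≤ 1 * 0 by simp⟩
  · intro i j hij
    exact Set.disjoint_left.2 fun g hi hj => hij (hlt hi.1 hj.1)
  · intro i j hij
    exact Set.disjoint_left.2 fun g hi hj => hij (hlt hi.1 hj.1)
  · intro i j
    refine Set.disjoint_left.2 fun g hi hj => ?_
    obtain rfl := hlt hi.1 hj.1
    exact hj.2.not_ge hi.2
  · rintro i _ ⟨g, hg, rfl⟩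
    have := pingPong_step hq (h0 i g) hg
    rw [← elementaryPair_mul_apply_self, ← elementaryPair_mul_apply_succ q i g] at this
    exact this
  · rintro i _ ⟨g, hg, rfl⟩
    have := pingPong_step_neg hq (h0 i g) hg
    rw [← elementaryPair_mul_apply_self, ← elementaryPair_mul_apply_succ (-q) i g,
      ← elementaryPair_inv] at this
    exact this

theorem dvd_lift_elementaryPair_sub_one {p : ℕ} (y : FreeGroup (Fin 2)) :
    (p : Matrix (Fin 2) (Fin 2) ℤ) ∣ (FreeGroup.lift (elementaryPair (p ^ 2)) y).1 - 1 := by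
  have h : (Matrix.SpecialLinearGroup.map (Int.castRingHom (ZMod p))).comp
      (FreeGroup.lift (elementaryPair (p ^ 2))) = 1 := by
    refine FreeGroup.ext_hom _ _ fun i => ?_
    rw [MonoidHom.comp_apply, FreeGroup.lift_apply_of]
    refine Subtype.ext ?_
    change (elementaryPair (p ^ 2) i).1.map (Int.castRingHom (ZMod p)) = 1
    fin_cases i <;> ext j k <;> fin_cases j <;> fin_cases k <;> simp [elementaryPair]
  have hij (i j) : (p : ℤ) ∣ (FreeGroup.lift (elementaryPair (p ^ 2)) y).1 i j -
      (1 : Matrix (Fin 2) (Fin 2) ℤ) i j := by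
    have h1 := congrFun (congrFun (congrArg Subtype.val (DFunLike.congr_fun h y)) i) j
    rw [← ZMod.intCast_zmod_eq_zero_iff_dvd, Int.cast_sub, sub_eq_zero]
    refine Eq.trans h1 ?_
    fin_cases i <;> fin_cases j <;> simp
  choose c hc using hij
  refine ⟨Matrix.of c, ?_⟩
  ext i j
  rw [← nsmul_eq_mul, Matrix.sub_apply, hc]
  simp

/-- The representation of the free group of rank two over `ℤ / p ^ k` by elementary matrices
congruent to `1` modulo `p`. -/
def elementaryRepr (p k : ℕ) :
    FreeGroup (Fin 2) →* Matrix.SpecialLinearGroup (Fin 2) (ZMod (p ^ k)) :=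
  (Matrix.SpecialLinearGroup.map (Int.castRingHom (ZMod (p ^ k)))).comp
    (FreeGroup.lift (elementaryPair (p ^ 2)))

theorem elementaryRepr_eq_one_iff {p k : ℕ} {y : FreeGroup (Fin 2)} :
    elementaryRepr p k y = 1 ↔ ∀ i j, ((p ^ k : ℕ) : ℤ) ∣
      ((FreeGroup.lift (elementaryPair (p ^ 2)) y).1 - 1) i j := by
  refine Subtype.ext_iff.trans (Matrix.ext_iff.symm.trans ?_)
  refine forall_congr' fun i => forall_congr' fun j => ?_
  rw [← ZMod.intCast_zmod_eq_zero_iff_dvd, Matrix.sub_apply, Int.cast_sub, sub_eq_zero]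
  have e : (((1 : Matrix (Fin 2) (Fin 2) ℤ) i j : ℤ) : ZMod (p ^ k)) =
      (1 : Matrix (Fin 2) (Fin 2) (ZMod (p ^ k))) i j := by
    fin_cases i <;> fin_cases j <;> simp
  rw [e]
  rfl

theorem isPGroup_range_elementaryRepr {p : ℕ} (hp : p.Prime) (k : ℕ) :
    IsPGroup p (elementaryRepr p k).range := by
  rintro ⟨_, y, rfl⟩
  refine ⟨k, Subtype.ext ?_⟩
  change elementaryRepr p k y ^ p ^ k = 1
  rw [← map_pow, elementaryRepr_eq_one_iff]
  intro i j
  obtain ⟨c, hc⟩ := pow_succ_dvd_pow_pow_sub_one hp (dvd_lift_elementaryPair_sub_one (p := p) y) k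
  rw [map_pow]
  change _ ∣ ((FreeGroup.lift (elementaryPair (p ^ 2)) y).1 ^ p ^ k - 1) i j
  rw [hc, ← nsmul_eq_mul, Matrix.smul_apply, nsmul_eq_mul, pow_succ, Nat.cast_mul, mul_assoc]
  exact dvd_mul_right _ _

/-- The free group of rank two is residually finite-`p`. -/
theorem exists_elementaryRepr_ne_one {p : ℕ} (hp : p.Prime) {x : FreeGroup (Fin 2)}
    (hx : x ≠ 1) : ∃ k, elementaryRepr p k x ≠ 1 := by
  by_contra! h
  -- Using `p ^ 2` instead of `p` ensures `q ≥ 3` even for `p = 2`.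
  refine hx (injective_lift_elementaryPair (q := (p : ℤ) ^ 2) ?_ ?_)
  · have := hp.two_le
    zify at this
    nlinarith
  · rw [map_one]
    refine Subtype.ext (sub_eq_zero.1 ?_)
    ext i j
    -- With `k` the absolute value of the entry, `p ^ k` exceeds the entry it divides.
    refine Int.eq_zero_of_abs_lt_dvd (elementaryRepr_eq_one_iff.1
      (h (((FreeGroup.lift (elementaryPair (p ^ 2)) x).1 - 1) i j).natAbs) i j) ?_
    rw [Int.abs_eq_natAbs]
    exact_mod_cast Nat.lt_pow_self hp.one_lt

/-! ### The action on homomorphisms to a finite `p`-group -/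

section Action

variable (F P : Type*) [Group F] [Group P]

/-- `F` acts on `Hom(F, P) × P` by `x • (f, y) = (f, f x * y)`. -/
def homProdLeft : F →* Equiv.Perm ((F →* P) × P) where
  toFun x :=
    { toFun := fun a => (a.1, a.1 x * a.2)
      invFun := fun a => (a.1, (a.1 x)⁻¹ * a.2)
      left_inv := fun a => by simp
      right_inv := fun a => by simp }
  map_one' := by ext a <;> simp
  map_mul' x y := by ext a <;> simp [mul_assoc]

/-- `Aut F` acts on `Hom(F, P) × P` by precomposition with the inverse on the first factor. -/
def homProdAut : MulAut F →* Equiv.Perm ((F →* P) × P) where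
  toFun α :=
    { toFun := fun a => (a.1.comp (α⁻¹ : MulAut F).toMonoidHom, a.2)
      invFun := fun a => (a.1.comp α.toMonoidHom, a.2)
      left_inv := fun a => by
        refine Prod.ext (MonoidHom.ext fun x => ?_) rfl
        exact congrArg a.1 (MulAut.inv_apply_self F α x)
      right_inv := fun a => by
        refine Prod.ext (MonoidHom.ext fun x => ?_) rfl
        exact congrArg a.1 (MulAut.apply_inv_self F α x) }
  map_one' := rfl
  map_mul' α β := by
    refine Equiv.ext fun a => Prod.ext (MonoidHom.ext fun x => ?_) rfl
    exact congrArg a.1 (DFunLike.congr_fun (mul_inv_rev α β) x)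

variable {F}

/-- The action of a semidirect product `F ⋊ A` on `Hom(F, P) × P`. -/
def homProdAction {A : Type*} [Group A] (θ : A →* MulAut F) :
    F ⋊[θ] A →* Equiv.Perm ((F →* P) × P) :=
  SemidirectProduct.lift (homProdLeft F P) ((homProdAut F P).comp θ) fun a => by
    refine MonoidHom.ext fun x => ?_
    rw [MonoidHom.comp_apply, MonoidHom.comp_apply, MulEquiv.toMonoidHom_eq_coe,
      MulEquiv.toMonoidHom_eq_coe, MonoidHom.coe_coe, MonoidHom.coe_coe, MulAut.conj_apply,
      eq_mul_inv_iff_mul_eq]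
    refine Equiv.ext fun b => Prod.ext rfl ?_
    exact congrArg (b.1 · * b.2) (MulAut.inv_apply_self F (θ a) x)

variable {P}

theorem homProdAction_inl_eq_one_iff {A : Type*} [Group A] (θ : A →* MulAut F) (x : F) :
    homProdAction P θ (SemidirectProduct.inl x) = 1 ↔ ∀ f : F →* P, f x = 1 := by
  rw [homProdAction, SemidirectProduct.lift_inl]
  constructor
  · intro h f
    have := congrArg Prod.snd (Equiv.congr_fun h (f, 1))
    exact (mul_one (f x)).symm.trans this
  · intro h
    refine Equiv.ext fun a => Prod.ext rfl ?_
    change a.1 x * a.2 = a.2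
    rw [h, one_mul]

theorem homProdAction_inr {A : Type*} [Group A] (θ : A →* MulAut F) (a : A) :
    homProdAction P θ (SemidirectProduct.inr a) = homProdAut F P (θ a) := by
  rw [homProdAction, SemidirectProduct.lift_inr, MonoidHom.comp_apply]

theorem homProdAut_eq_one_of_forall {α : MulAut F} (h : ∀ (f : F →* P) x, f (α x) = f x) :
    homProdAut F P α = 1 := by
  rw [← inv_eq_one, ← map_inv]
  refine Equiv.ext fun a => Prod.ext (MonoidHom.ext fun x => ?_) rfl
  change a.1 ((α⁻¹⁻¹ : MulAut F) x) = a.1 x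
  rw [inv_inv, h]

end Action

theorem isPGroup_range_homProdAction {φ : MulAut (FreeGroup (Fin 2))}
    (hdet : (abelianizedMatrix φ).det = 1) {p : ℕ} (hp : p.Prime)
    (htr : (p : ℤ) ∣ (abelianizedMatrix φ).trace - 2) {P : Type*} [Group P]
    [Finite P] (hP : IsPGroup p P) :
    IsPGroup p (homProdAction P (zpowersHom (MulAut (FreeGroup (Fin 2))) φ⁻¹)).range := by
  have : Fact p.Prime := ⟨hp⟩
  obtain ⟨m, hm⟩ := exists_apply_pow_eq hdet hp htr P hP
  obtain ⟨a, ha⟩ := IsPGroup.iff_card.1 hP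
  rintro ⟨_, g, rfl⟩
  refine ⟨m + a, Subtype.ext ?_⟩
  set Θ := homProdAction P (zpowersHom (MulAut (FreeGroup (Fin 2))) φ⁻¹)
  change Θ g ^ p ^ (m + a) = 1
  have h1 : Θ (SemidirectProduct.inr (g.right ^ p ^ m)) = 1 := by
    rw [homProdAction_inr, map_pow,
      zpowersHom_apply, ← zpow_natCast, ← zpow_mul, mul_comm, zpow_mul, map_zpow, inv_zpow,
      zpow_natCast, map_inv, homProdAut_eq_one_of_forall hm, inv_one, one_zpow]
  have h2 (x) : Θ (SemidirectProduct.inl x) ^ p ^ a = 1 := by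
    rw [← map_pow, ← map_pow, homProdAction_inl_eq_one_iff]
    intro f
    rw [map_pow, ← ha, pow_card_eq_one']
  -- `t ^ p ^ m` acts trivially, so `g ^ p ^ m` acts as an element of `F₂`, whose order divides `|P|
  -- = p ^ a`.
  have h3 : Θ g ^ p ^ m = Θ (SemidirectProduct.inl (g ^ p ^ m).left) := by
    have h4 := SemidirectProduct.inl_left_mul_inr_right (g ^ p ^ m)
    have h5 : (g ^ p ^ m).right = g.right ^ p ^ m := map_pow SemidirectProduct.rightHom g _
    rw [← map_pow]
    conv_lhs => rw [← h4]
    rw [map_mul, h5, h1, mul_one]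
  rw [pow_add, pow_mul, h3, h2]

theorem isResiduallyNilpotent_of_dvd {φ : MulAut (FreeGroup (Fin 2))}
    (hdet : (abelianizedMatrix φ).det = 1) {p : ℕ} (hp : p.Prime)
    (htr : (p : ℤ) ∣ (abelianizedMatrix φ).trace - 2) :
    IsResiduallyNilpotent (FreeByCyclic φ) := by
  have : Fact p.Prime := ⟨hp⟩
  suffices H : ∀ g : FreeByCyclic φ, g ≠ 1 → ∃ (Q : Type) (_ : Group Q) (f : FreeByCyclic φ →* Q),
      f g ≠ 1 ∧ Group.IsNilpotent f.range by
    intro g hg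
    obtain ⟨Q, _, f, hf, _⟩ := H g hg
    exact ⟨f.ker, inferInstance, hf,
      Group.nilpotent_of_mulEquiv (QuotientGroup.quotientKerEquivRange f).symm⟩
  intro g hg
  by_cases hr : g.right = 1
  · have hl : g.left ≠ 1 := fun h => hg (SemidirectProduct.ext h hr)
    have hgl : g = SemidirectProduct.inl g.left := SemidirectProduct.ext rfl hr
    obtain ⟨k, hk⟩ := exists_elementaryRepr_ne_one hp hl
    have : NeZero (p ^ k) := ⟨pow_ne_zero _ hp.ne_zero⟩
    have : Finite (Matrix.SpecialLinearGroup (Fin 2) (ZMod (p ^ k))) := Subtype.finite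
    let P := (elementaryRepr p k).range
    have : Finite (FreeGroup (Fin 2) →* P) := Finite.of_equiv (Fin 2 → P) FreeGroup.lift
    refine ⟨_, _, homProdAction P _, ?_,
      (isPGroup_range_homProdAction hdet hp htr (isPGroup_range_elementaryRepr hp k)).isNilpotent⟩
    rw [hgl, Ne, homProdAction_inl_eq_one_iff]
    intro h
    exact hk (congrArg Subtype.val (h (elementaryRepr p k).rangeRestrict))
  · exact ⟨_, _, SemidirectProduct.rightHom, hr, inferInstance⟩

theorem mainTheorem12 (φ : MulAut (FreeGroup (Fin 2)))
    (hdet : (abelianizedMatrix φ).det = 1) :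
    IsResiduallyNilpotent (FreeByCyclic φ) ↔
      (abelianizedMatrix φ).trace ∉ ({1, 3} : Set ℤ) := by 
  refine ⟨fun h htr => not_isResiduallyNilpotent hdet htr h, fun htr => ?_⟩
  -- When the trace is `2` the number is `0` and any prime serves.
  obtain ⟨p, hp, hdvd⟩ := Nat.exists_prime_and_dvd
    (n := ((abelianizedMatrix φ).trace - 2).natAbs) fun h => htr <| by
      simp only [Set.mem_insert_iff, Set.mem_singleton_iff]
      omega
  exact isResiduallyNilpotent_of_dvd hdet hp (Int.natCast_dvd.2 hdvd)
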